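/- Let $\Lambda=\mathbb{Q}$ or $\Lambda=\mathbb{Z}_p$ for a prime $p$. On $\mathbb{C}^n$, $n\ge 1$, use coordinates $x_j+iy_j$. Consider immersions $f\colon L\to\mathbb{C}^n$ with the following properties: $L$ is a closed (compact, without boundary, not necessarily connected) smooth $n$-manifold, which is assumed to be spin unless $\Lambda=\mathbb{Z}_2$; $f$ is an exact Lagrangian immersion, i.e. a smooth immersion with $f^*\big(\sum_j dx_j\wedge dy_j\big)=0$ and $f^*\big(\sum_j y_j\,dx_j\big)=dz$ for some smooth $z\colon L\to\mathbb{R}$; and $f$ is self-transverse, i.e. any two sheets meeting at a point of $\mathbb{C}^n$ are transverse there, and there are no triple points. Let $R(f)$ be the number of double points of $f$, and $\dim H_*(L;\Lambda)$ the total dimension over $\Lambda$ of the singular homology of $L$. Suppose that there is a constant $K$ such that, for every $n\ge 1$ and every such $f\colon L\to\mathbb{C}^n$, $$R(f)\ \ge\ \tfrac12\dim H_*(L;\Lambda)-K .$$ Then, for every $n\ge 1$ and every such $f\colon L\to\mathbb{C}^n$, $$R(f)\ \ge\ \tfrac12\dim H_*(L;\Lambda).$$ -/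

import Mathlib

open scoped Manifold ContDiff NNReal ENNReal

noncomputable section

namespace ExactLagrangian

/-- The model space `ℝⁿ`. -/
abbrev Rn (n : ℕ) : Type := EuclideanSpace ℝ (Fin n)

/-- The target `ℂⁿ`, with coordinates `x_j + i y_j`. It is regarded as a real vector space. -/
abbrev Cn (n : ℕ) : Type := EuclideanSpace ℂ (Fin n)

/-- The Liouville form `∑ y_j dx_j` on `ℂⁿ`, at the point `p`, applied to the vector `v`. -/
def liouville {n : ℕ} (p v : Cn n) : ℝ := ∑ j, (p j).im * (v j).re

/-- The standard symplectic form `∑ dx_j ∧ dy_j` on `ℂⁿ`. -/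
def omega {n : ℕ} (u v : Cn n) : ℝ := ∑ j, ((u j).re * (v j).im - (u j).im * (v j).re)

section Immersions

variable {n : ℕ} {L : Type} [TopologicalSpace L] [ChartedSpace (Rn n) L]

/-- The differential at `x` of a map `f : L → ℂⁿ`, as a real linear map `T_x L → ℂⁿ`. -/
def diff (f : L → Cn n) (x : L) : TangentSpace 𝓘(ℝ, Rn n) x →L[ℝ] Cn n :=
  mfderiv 𝓘(ℝ, Rn n) 𝓘(ℝ, Cn n) f x

/-- The differential at `x` of a real function `z : L → ℝ`. -/
def diffReal (z : L → ℝ) (x : L) : TangentSpace 𝓘(ℝ, Rn n) x →L[ℝ] ℝ :=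
  mfderiv 𝓘(ℝ, Rn n) 𝓘(ℝ, ℝ) z x

/-- Lagrangian immersions of an `n`-manifold `L` (charts in `ℝⁿ`) into `ℂⁿ`: smooth maps with
injective differentials that pull the symplectic form back to zero. -/
structure IsLagrangianImmersion (f : L → Cn n) : Prop where
  smooth : ContMDiff 𝓘(ℝ, Rn n) 𝓘(ℝ, Cn n) ∞ f
  injective_diff : ∀ x : L, Function.Injective (diff f x)
  lagrangian : ∀ (x : L) (u v : TangentSpace 𝓘(ℝ, Rn n) x), omega (diff f x u) (diff f x v) = 0

/-- A Lagrangian immersion `f` is exact if `f^*(∑ y_j dx_j) = dz` for a smooth function `z`. -/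
structure IsExactLagrangianImmersion (f : L → Cn n) : Prop extends IsLagrangianImmersion f where
  exact : ∃ z : L → ℝ, ContMDiff 𝓘(ℝ, Rn n) 𝓘(ℝ, ℝ) ∞ z ∧
    ∀ (x : L) (v : TangentSpace 𝓘(ℝ, Rn n) x), diffReal z x v = liouville (f x) (diff f x v)

/-- The self-intersections of `f` are transverse double points: the two sheets through a point
of self-intersection are transverse, and there are no triple points. -/
structure IsSelfTransverse (f : L → Cn n) : Prop where
  transverse : ∀ x y : L, x ≠ y → f x = f y →
    LinearMap.range (diff f x).toLinearMap ⊔ LinearMap.range (diff f y).toLinearMap = ⊤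
  no_triple : ∀ x y w : L, f x = f y → f y = f w → x = y ∨ y = w ∨ x = w

/-- The number `R(f)` of double points of `f`: points of the target with more than one
preimage. -/
def numDoublePoints (f : L → Cn n) : ℕ∞ :=
  Set.encard {p : Cn n | ∃ x y : L, x ≠ y ∧ f x = p ∧ f y = p}

end Immersions

/-- The quadratic form `|v|²` on `ℝⁿ`. -/
def normSqForm (n : ℕ) : QuadraticForm ℝ (Rn n) :=
  LinearMap.BilinMap.toQuadraticMap (innerₗ (Rn n))

/-- Spin structures on the tangent bundle of `L`, as cocycles. `frame i` is a continuous local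
frame of `TL` over the open set `U i`. Over `U i ∩ U j` the change of frames at `x` is the image of
`lift i j x` under the double covering `Spin(n) → SO(n)`, `g ↦ (v ↦ g v g⁻¹)`, so that the frames
define an orientation and a Riemannian metric; `g⁻¹ = star g` for `g` in `Spin(n)`. The lifts are
continuous (the Clifford algebra is a finite-dimensional real vector space) and satisfy the cocycle
condition. -/
structure SpinStructure (n : ℕ) (L : Type) [TopologicalSpace L] [ChartedSpace (Rn n) L]
    [IsManifold 𝓘(ℝ, Rn n) ∞ L] where
  /-- the index set of the cover -/
  index : Type
  /-- the cover -/
  U : index → Set L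
  isOpen_U : ∀ i, IsOpen (U i)
  cover : ∀ x : L, ∃ i, x ∈ U i
  /-- the local frames -/
  frame : ∀ (_ : index) (x : L), Rn n ≃L[ℝ] TangentSpace 𝓘(ℝ, Rn n) x
  continuousOn_frame : ∀ (i : index) (v : Rn n),
    ContinuousOn (fun x : L => (⟨x, frame i x v⟩ : TangentBundle 𝓘(ℝ, Rn n) L)) (U i)
  /-- the `Spin(n)`-valued transition functions -/
  lift : index → index → L → CliffordAlgebra (normSqForm n)
  lift_mem : ∀ i j, ∀ x ∈ U i ∩ U j, lift i j x ∈ spinGroup (normSqForm n)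
  continuousOn_lift : ∀ (i j : index) (φ : CliffordAlgebra (normSqForm n) →ₗ[ℝ] ℝ),
    ContinuousOn (fun x : L => φ (lift i j x)) (U i ∩ U j)
  lift_covers : ∀ i j, ∀ x ∈ U i ∩ U j, ∀ v : Rn n,
    lift i j x * CliffordAlgebra.ι (normSqForm n) v * star (lift i j x) =
      CliffordAlgebra.ι (normSqForm n) ((frame i x).symm (frame j x v))
  cocycle : ∀ i j k, ∀ x ∈ U i ∩ U j ∩ U k, lift i j x * lift j k x = lift i k x

/-- The manifold `L` is spin: it admits a spin structure (in particular it is orientable). -/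
def IsSpin (n : ℕ) (L : Type) [TopologicalSpace L] [ChartedSpace (Rn n) L]
    [IsManifold 𝓘(ℝ, Rn n) ∞ L] : Prop :=
  Nonempty (SpinStructure n L)

/-- The `i`-th singular homology `H_i(X; Λ)`. -/
abbrev homology (Λ : Type) [Field Λ] (X : Type) [TopologicalSpace X] (i : ℕ) : ModuleCat.{0} Λ :=
  ((AlgebraicTopology.singularHomologyFunctor (ModuleCat.{0} Λ) i).obj
    (ModuleCat.of Λ Λ)).obj (TopCat.of X)

/-- The dimension over `Λ` of the total singular homology `H_*(X; Λ) = ⨁_i H_i(X; Λ)`. -/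
def dimHomology (Λ : Type) [Field Λ] (X : Type) [TopologicalSpace X] : ℕ∞ :=
  Cardinal.toENat (Module.rank Λ (DirectSum ℕ fun i => homology Λ X i))

end ExactLagrangian

end

noncomputable section

namespace ExactLagrangian

/-! ### Singular homology of a disjoint union -/

section Homology

open CategoryTheory Limits AlgebraicTopology

/-! The class of admissible immersions is closed under disjoint union, because manifolds need not be
connected. Given `f`, translate a second copy by a real vector `c` so large that the two images are
disjoint. The union is again exact Lagrangian, self-transverse and (if required) spin, has at most
twice the double points, and has at least twice the total homology. Applying the bound with error
`K` to the union and dividing by two gives the bound for `f` with error `K / 2`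
(`DoublePointBound.half`). Iterating gives error `K / 2 ^ m` for every `m`, and letting `m` grow
removes it. Only one inequality is needed on each side: `dimHomology_add_le_sum` for homology and
`numDoublePoints_sumElim_le` for double points. -/

theorem continuousMap_sum_factors {Δ X Y : Type*} [TopologicalSpace Δ] [TopologicalSpace X]
    [TopologicalSpace Y] [ConnectedSpace Δ] (s : C(Δ, X ⊕ Y)) :
    (∃ t : C(Δ, X), ∀ x, Sum.inl (t x) = s x) ∨ ∃ t : C(Δ, Y), ∀ x, Sum.inr (t x) = s x := by
  rcases Sum.isConnected_iff.1 (isConnected_range s.continuous) with ⟨t, -, ht⟩ | ⟨t, -, ht⟩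
  · left
    have h : ∀ x, ∃ y, Sum.inl y = s x := fun x => by
      obtain ⟨y, -, hy⟩ := ht ▸ Set.mem_range_self x
      exact ⟨y, hy⟩
    choose g hg using h
    exact ⟨⟨g, Topology.IsEmbedding.inl.continuous_iff.2
      (s.continuous.congr fun x => (hg x).symm)⟩, hg⟩
  · right
    have h : ∀ x, ∃ y, Sum.inr y = s x := fun x => by
      obtain ⟨y, -, hy⟩ := ht ▸ Set.mem_range_self x
      exact ⟨y, hy⟩
    choose g hg using h
    exact ⟨⟨g, Topology.IsEmbedding.inr.continuous_iff.2
      (s.continuous.congr fun x => (hg x).symm)⟩, hg⟩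

theorem toSSet_map_app_apply {X Y : TopCat.{0}} (f : X ⟶ Y) (n : SimplexCategoryᵒᵖ)
    (s : (TopCat.toSSet.obj X).obj n) (x : stdSimplex ℝ (Fin (n.unop.len + 1))) :
    Y.toSSetObjEquiv n ((TopCat.toSSet.map f).app n s) x = f (X.toSSetObjEquiv n s x) :=
  rfl

theorem toSSet_map_app_injective {X Y : TopCat.{0}} (f : X ⟶ Y) (hf : Function.Injective f)
    (n : SimplexCategoryᵒᵖ) : Function.Injective ((TopCat.toSSet.map f).app n) := by
  intro s t h
  apply (X.toSSetObjEquiv n).injective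
  ext x
  apply hf
  rw [← toSSet_map_app_apply, ← toSSet_map_app_apply, h]

/-- The singular simplicial set of a disjoint union is the coproduct of the singular simplicial
sets, since the standard simplices are connected. -/
def toSSetSumIsColimit (X Y : TopCat.{0}) :
    IsColimit (BinaryCofan.mk (TopCat.toSSet.map (TopCat.binaryCofan X Y).inl)
      (TopCat.toSSet.map (TopCat.binaryCofan X Y).inr)) := by
  -- Colimits of simplicial sets are computed levelwise, and a cofan of sets is a coproduct when
  -- both maps are injective with complementary ranges.
  refine evaluationJointlyReflectsColimits _ fun n => ?_
  refine (isColimitMapCoconeBinaryCofanEquiv _ _ _).symm ?_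
  refine Nonempty.some ((Types.binaryCofan_isColimit_iff _).2 ⟨?_, ?_, ?_⟩)
  · exact toSSet_map_app_injective (TopCat.binaryCofan X Y).inl Sum.inl_injective n
  · exact toSSet_map_app_injective (TopCat.binaryCofan X Y).inr Sum.inr_injective n
  · refine isCompl_iff.2 ⟨Set.disjoint_left.2 ?_, codisjoint_iff_le_sup.2 fun s _ => ?_⟩
    · rintro _ ⟨s, rfl⟩ ⟨t, h⟩
      have x : stdSimplex ℝ (Fin (n.unop.len + 1)) := Classical.arbitrary _
      have h' := congrArg (fun u => TopCat.toSSetObjEquiv _ n u x) h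
      exact Sum.inr_ne_inl h'
    · rcases continuousMap_sum_factors (TopCat.toSSetObjEquiv _ n s) with ⟨t, ht⟩ | ⟨t, ht⟩
      · refine Or.inl ⟨(X.toSSetObjEquiv n).symm t, ?_⟩
        apply (TopCat.toSSetObjEquiv _ n).injective
        ext x
        exact ht x
      · refine Or.inr ⟨(Y.toSSetObjEquiv n).symm t, ?_⟩
        apply (TopCat.toSSetObjEquiv _ n).injective
        ext x
        exact ht x

/-- A functor preserving zero morphisms splits the inclusions into a binary coproduct. -/
theorem exists_map_retraction_of_isColimit {C D : Type*} [Category C] [Category D]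
    [HasZeroMorphisms C] [HasZeroMorphisms D] {A B T : C} {u : A ⟶ T} {v : B ⟶ T}
    (h : IsColimit (BinaryCofan.mk u v)) (H : C ⥤ D) [H.PreservesZeroMorphisms] :
    ∃ (p : H.obj T ⟶ H.obj A) (q : H.obj T ⟶ H.obj B),
      H.map u ≫ p = 𝟙 _ ∧ H.map v ≫ p = 0 ∧ H.map u ≫ q = 0 ∧ H.map v ≫ q = 𝟙 _ := by
  obtain ⟨p, hup, hvp⟩ : ∃ p : T ⟶ A, u ≫ p = 𝟙 _ ∧ v ≫ p = 0 :=
    ⟨_, (BinaryCofan.IsColimit.desc' h (𝟙 _) 0).2⟩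
  obtain ⟨q, huq, hvq⟩ : ∃ q : T ⟶ B, u ≫ q = 0 ∧ v ≫ q = 𝟙 _ :=
    ⟨_, (BinaryCofan.IsColimit.desc' h 0 (𝟙 _)).2⟩
  refine ⟨H.map p, H.map q, ?_, ?_, ?_, ?_⟩
  all_goals rw [← H.map_comp]; simp [*]

/-- The functor taking a set to the free `Λ`-module on it preserves coproducts, so the simplicial
module of singular chains of `X ⊕ Y` is a coproduct. Its inclusions are split by maps built from
identities and zeros, and the splitting survives passage to homology. -/
theorem exists_homology_retraction (Λ : Type) [Field Λ] (X Y : Type) [TopologicalSpace X]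
    [TopologicalSpace Y] (i : ℕ) :
    ∃ (a : homology Λ X i →ₗ[Λ] homology Λ (X ⊕ Y) i)
      (b : homology Λ Y i →ₗ[Λ] homology Λ (X ⊕ Y) i)
      (p : homology Λ (X ⊕ Y) i →ₗ[Λ] homology Λ X i)
      (q : homology Λ (X ⊕ Y) i →ₗ[Λ] homology Λ Y i),
      (∀ x, p (a x) = x) ∧ (∀ y, p (b y) = 0) ∧ (∀ x, q (a x) = 0) ∧ (∀ y, q (b y) = y) := by
  let G : SSet.{0} ⥤ SimplicialObject (ModuleCat.{0} Λ) :=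
    (SimplicialObject.whiskering _ _).obj (sigmaConst.obj (ModuleCat.of Λ Λ))
  have : PreservesColimitsOfShape (Discrete WalkingPair) G :=
    inferInstanceAs (PreservesColimitsOfShape _ ((Functor.whiskeringRight _ _ _).obj _))
  obtain ⟨p, q, e1, e2, e3, e4⟩ := exists_map_retraction_of_isColimit
    (mapIsColimitOfPreservesOfIsColimit G _ _
      (toSSetSumIsColimit (TopCat.of X) (TopCat.of Y)))
    (alternatingFaceMapComplex _ ⋙ HomologicalComplex.homologyFunctor _ _ i)
  exact ⟨ModuleCat.Hom.hom _, ModuleCat.Hom.hom _, p.hom, q.hom,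
    fun x => congrArg (fun g => g.hom x) e1, fun x => congrArg (fun g => g.hom x) e2,
    fun x => congrArg (fun g => g.hom x) e3, fun x => congrArg (fun g => g.hom x) e4⟩

/-- The retractions make `H(X) ⊕ H(Y) → H(X ⊕ Y)` injective in each degree. No finiteness is needed,
since `Cardinal.toENat` is monotone. -/
theorem dimHomology_add_le_sum (Λ : Type) [Field Λ] (X Y : Type) [TopologicalSpace X]
    [TopologicalSpace Y] :
    dimHomology Λ X + dimHomology Λ Y ≤ dimHomology Λ (X ⊕ Y) := by
  choose a b p q hpa hpb hqa hqb using exists_homology_retraction Λ X Y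
  have hinj : Function.Injective
      ((DirectSum.lmap a).coprod (DirectSum.lmap b)) := by
    refine Function.LeftInverse.injective
      (g := (DirectSum.lmap p).prod (DirectSum.lmap q)) fun x => ?_
    ext i <;> simp [hpa, hpb, hqa, hqb]
  have h := LinearMap.rank_le_of_injective _ hinj
  rw [rank_prod'] at h
  simpa [dimHomology] using Cardinal.toENat.monotone' h

end Homology
-- Counting double points and separating two copies
section Counting

variable {n : ℕ}

theorem numDoublePoints_sumElim_le {L L' : Type} {f : L → Cn n} {g : L' → Cn n} (hfg : ∀ x y, f x ≠ g y) :
    numDoublePoints (Sum.elim f g) ≤ numDoublePoints f + numDoublePoints g := by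
  refine le_trans (Set.encard_le_encard ?_) (Set.encard_union_le _ _)
  rintro p ⟨x | x, y | y, hxy, hx, hy⟩
  · exact Or.inl ⟨x, y, fun e => hxy (e ▸ rfl), hx, hy⟩
  · exact absurd (hx.trans hy.symm) (hfg _ _)
  · exact absurd (hy.trans hx.symm) (hfg _ _)
  · exact Or.inr ⟨x, y, fun e => hxy (e ▸ rfl), hx, hy⟩

theorem numDoublePoints_add_const_le {L : Type} (f : L → Cn n) (c : Cn n) :
    numDoublePoints (fun x => f x + c) ≤ numDoublePoints f := by
  refine le_trans (Set.encard_le_encard ?_) (Set.encard_image_le (· + c) _)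
  rintro p ⟨x, y, hxy, hx, hy⟩
  exact ⟨f x, ⟨x, y, hxy, rfl, add_right_cancel (hy.trans hx.symm)⟩, hx⟩

/-- A compact subset of `ℂⁿ`, `n ≥ 1`, is disjoint from its translates by large real vectors. -/
theorem exists_real_translation_disjoint {L : Type} [TopologicalSpace L] [CompactSpace L] (hn : 1 ≤ n) {f : L → Cn n}
    (hf : Continuous f) : ∃ c : Cn n, (∀ j, (c j).im = 0) ∧ ∀ x y, f x ≠ f y + c := by
  obtain ⟨R, hR⟩ := (isCompact_range hf).isBounded.exists_norm_le
  -- Two points of the image differ by at most `2 * |R|` in norm, so a shift of length `2 * |R| + 1`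
  -- suffices; `n ≥ 1` supplies the coordinate. The absolute value covers empty `L`, where `R` may
  -- be negative.
  refine ⟨EuclideanSpace.single ⟨0, hn⟩ ((2 * |R| + 1 : ℝ) : ℂ), fun j => ?_, fun x y h => ?_⟩
  · by_cases hj : j = ⟨0, hn⟩ <;> simp [hj]
  · have hc : ‖f x - f y‖ = 2 * |R| + 1 := by
      rw [h, add_sub_cancel_left, PiLp.norm_single, Complex.norm_real, Real.norm_eq_abs,
        abs_of_nonneg (by positivity)]
    have h1 := norm_sub_le (f x) (f y)
    have h2 := hR _ (Set.mem_range_self x)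
    have h3 := hR _ (Set.mem_range_self y)
    have h4 := le_abs_self R
    linarith

end Counting

/-! ### Disjoint unions of immersions -/

section DisjointUnion

variable {n : ℕ} {L L' : Type} [TopologicalSpace L] [ChartedSpace (Rn n) L]
  [TopologicalSpace L'] [ChartedSpace (Rn n) L']

/-- Chain rule for `Sum.elim f g ∘ Sum.inl = f`: the inclusion has identity derivative in the charts
of the sum. -/
theorem mfderiv_sumElim_inl {E : Type*} [NormedAddCommGroup E] [NormedSpace ℝ E]
    {f : L → E} {g : L' → E} {x : L}
    (h : MDifferentiableAt 𝓘(ℝ, Rn n) 𝓘(ℝ, E) (Sum.elim f g) (Sum.inl x : L ⊕ L')) :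
    mfderiv 𝓘(ℝ, Rn n) 𝓘(ℝ, E) (Sum.elim f g) (Sum.inl x : L ⊕ L') =
      mfderiv 𝓘(ℝ, Rn n) 𝓘(ℝ, E) f x := by
  have h' := mfderiv_comp x h
    ((ContMDiff.inl (n := ∞) (I := 𝓘(ℝ, Rn n)) (M := L) (M' := L')).mdifferentiable (by simp) x)
  rw [Sum.elim_comp_inl] at h'
  rw [h', mfderiv_sumInl (p := Sum.inl x)]
  exact (ContinuousLinearMap.comp_id _).symm

theorem mfderiv_sumElim_inr {E : Type*} [NormedAddCommGroup E] [NormedSpace ℝ E]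
    {f : L → E} {g : L' → E} {x : L'}
    (h : MDifferentiableAt 𝓘(ℝ, Rn n) 𝓘(ℝ, E) (Sum.elim f g) (Sum.inr x : L ⊕ L')) :
    mfderiv 𝓘(ℝ, Rn n) 𝓘(ℝ, E) (Sum.elim f g) (Sum.inr x : L ⊕ L') =
      mfderiv 𝓘(ℝ, Rn n) 𝓘(ℝ, E) g x := by
  have h' := mfderiv_comp x h
    ((ContMDiff.inr (n := ∞) (I := 𝓘(ℝ, Rn n)) (M := L) (M' := L')).mdifferentiable (by simp) x)
  rw [Sum.elim_comp_inr] at h'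
  rw [h', mfderiv_sumInr]
  exact (ContinuousLinearMap.comp_id _).symm

theorem IsExactLagrangianImmersion.sumElim {f : L → Cn n} {g : L' → Cn n}
    (hf : IsExactLagrangianImmersion f) (hg : IsExactLagrangianImmersion g) :
    IsExactLagrangianImmersion (Sum.elim f g) := by
  have hs := hf.smooth.sumElim hg.smooth
  have hl : ∀ x : L, diff (Sum.elim f g) (Sum.inl x) = diff f x := fun x =>
    mfderiv_sumElim_inl (hs.mdifferentiable (by simp) _)
  have hr : ∀ x : L', diff (Sum.elim f g) (Sum.inr x) = diff g x := fun x =>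
    mfderiv_sumElim_inr (hs.mdifferentiable (by simp) _)
  obtain ⟨z, hz, hzf⟩ := hf.exact
  obtain ⟨w, hw, hwg⟩ := hg.exact
  have hzw := hz.sumElim hw
  refine ⟨⟨hs, ?_, ?_⟩, Sum.elim z w, hzw, ?_⟩
  · rintro (x | x)
    · rw [hl]; exact hf.injective_diff x
    · rw [hr]; exact hg.injective_diff x
  · rintro (x | x)
    · rw [hl]; exact hf.lagrangian x
    · rw [hr]; exact hg.lagrangian x
  · rintro (x | x) v
    · rw [hl, diffReal, mfderiv_sumElim_inl (hzw.mdifferentiable (by simp) _)]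
      exact hzf x v
    · rw [hr, diffReal, mfderiv_sumElim_inr (hzw.mdifferentiable (by simp) _)]
      exact hwg x v

theorem IsSelfTransverse.sumElim {f : L → Cn n} {g : L' → Cn n}
    (hsf : ContMDiff 𝓘(ℝ, Rn n) 𝓘(ℝ, Cn n) ∞ f) (hsg : ContMDiff 𝓘(ℝ, Rn n) 𝓘(ℝ, Cn n) ∞ g)
    (hf : IsSelfTransverse f) (hg : IsSelfTransverse g) (hfg : ∀ x y, f x ≠ g y) :
    IsSelfTransverse (Sum.elim f g) := by
  have hs := hsf.sumElim hsg
  have hl : ∀ x : L, diff (Sum.elim f g) (Sum.inl x) = diff f x := fun x =>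
    mfderiv_sumElim_inl (hs.mdifferentiable (by simp) _)
  have hr : ∀ x : L', diff (Sum.elim f g) (Sum.inr x) = diff g x := fun x =>
    mfderiv_sumElim_inr (hs.mdifferentiable (by simp) _)
  refine ⟨?_, ?_⟩
  · rintro (x | x) (y | y) hxy h
    · rw [hl, hl]; exact hf.transverse x y (fun e => hxy (e ▸ rfl)) h
    · exact absurd h (hfg x y)
    · exact absurd h.symm (hfg y x)
    · rw [hr, hr]; exact hg.transverse x y (fun e => hxy (e ▸ rfl)) h
  · rintro (x | x) (y | y) (w | w) h h'
    · simpa using hf.no_triple x y w h h'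
    · exact absurd h' (hfg _ _)
    · exact absurd h (hfg _ _)
    · exact absurd h (hfg _ _)
    · exact absurd h.symm (hfg _ _)
    · exact absurd h.symm (hfg _ _)
    · exact absurd h'.symm (hfg _ _)
    · simpa using hg.no_triple x y w h h'

end DisjointUnion

/-! ### Translates of immersions -/

section Translation

variable {n : ℕ} {L : Type} [TopologicalSpace L] [ChartedSpace (Rn n) L]

theorem diff_add_const (f : L → Cn n) (c : Cn n) (x : L) :
    diff (fun y => f y + c) x = diff f x := by
  by_cases h : MDifferentiableAt 𝓘(ℝ, Rn n) 𝓘(ℝ, Cn n) f x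
  · have h' := h.hasMFDerivAt.add (hasMFDerivAt_const (I := 𝓘(ℝ, Rn n)) (I' := 𝓘(ℝ, Cn n)) c x)
    exact h'.mfderiv.trans (add_zero _)
  -- If `f` is not differentiable at `x`, neither is its translate, and both derivatives take the
  -- default value zero.
  · have h' : ¬ MDifferentiableAt 𝓘(ℝ, Rn n) 𝓘(ℝ, Cn n) (fun y => f y + c) x := fun h' => h <| by
      have := h'.add (mdifferentiableAt_const (I := 𝓘(ℝ, Rn n)) (I' := 𝓘(ℝ, Cn n)) (c := -c))
      have e : (fun y => f y + c) + (fun _ => -c) = f := funext fun y => add_neg_cancel_right _ _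
      rwa [e] at this
    rw [diff, diff, mfderiv_zero_of_not_mdifferentiableAt h,
      mfderiv_zero_of_not_mdifferentiableAt h']
    rfl

/-- A real translation leaves the coordinates `y_j` unchanged, so it preserves `∑ y_j dx_j` and the
same primitive `z` works. -/
theorem IsExactLagrangianImmersion.add_const {f : L → Cn n} (hf : IsExactLagrangianImmersion f)
    {c : Cn n} (hc : ∀ j, (c j).im = 0) : IsExactLagrangianImmersion fun x => f x + c := by
  obtain ⟨z, hz, hzf⟩ := hf.exact
  refine ⟨⟨hf.smooth.add contMDiff_const, fun x => ?_, fun x => ?_⟩, z, hz, fun x v => ?_⟩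
  · rw [diff_add_const]; exact hf.injective_diff x
  · rw [diff_add_const]; exact hf.lagrangian x
  · rw [diff_add_const, hzf]; simp [liouville, hc]

theorem IsSelfTransverse.add_const {f : L → Cn n} (hf : IsSelfTransverse f) (c : Cn n) :
    IsSelfTransverse fun x => f x + c := by
  refine ⟨fun x y hxy h => ?_, fun x y w h h' =>
    hf.no_triple x y w (add_right_cancel h) (add_right_cancel h')⟩
  rw [diff_add_const, diff_add_const]
  exact hf.transverse x y hxy (add_right_cancel h)

end Translation

/-! ### Spin structures on disjoint unions -/

section Spin

variable {n : ℕ} {L L' : Type} [TopologicalSpace L] [ChartedSpace (Rn n) L]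
  [IsManifold 𝓘(ℝ, Rn n) ∞ L] [TopologicalSpace L'] [ChartedSpace (Rn n) L']
  [IsManifold 𝓘(ℝ, Rn n) ∞ L']

theorem continuous_tangentBundle_inl : Continuous (fun p : TangentBundle 𝓘(ℝ, Rn n) L =>
    (⟨Sum.inl p.1, p.2⟩ : TangentBundle 𝓘(ℝ, Rn n) (L ⊕ L'))) := by
  have : IsManifold 𝓘(ℝ, Rn n) 1 L := .of_le (n := ∞) (by simp)
  have : IsManifold 𝓘(ℝ, Rn n) 1 L' := .of_le (n := ∞) (by simp)
  have h := (ContMDiff.inl (n := 1) (I := 𝓘(ℝ, Rn n)) (M := L) (M' := L')).continuous_tangentMap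
    le_rfl
  refine h.congr fun p => ?_
  rw [tangentMap, mfderiv_sumInl (p := Sum.inl p.1)]
  rfl

theorem continuous_tangentBundle_inr : Continuous (fun p : TangentBundle 𝓘(ℝ, Rn n) L' =>
    (⟨Sum.inr p.1, p.2⟩ : TangentBundle 𝓘(ℝ, Rn n) (L ⊕ L'))) := by
  have : IsManifold 𝓘(ℝ, Rn n) 1 L := .of_le (n := ∞) (by simp)
  have : IsManifold 𝓘(ℝ, Rn n) 1 L' := .of_le (n := ∞) (by simp)
  have h := (ContMDiff.inr (n := 1) (I := 𝓘(ℝ, Rn n)) (M := L) (M' := L')).continuous_tangentMap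
    le_rfl
  refine h.congr fun p => ?_
  rw [tangentMap, mfderiv_sumInr]
  rfl

/-- The disjoint union of two spin structures. -/
def SpinStructure.sum (S : SpinStructure n L) (S' : SpinStructure n L') :
    SpinStructure n (L ⊕ L') where
  index := S.index ⊕ S'.index
  U := Sum.elim (fun i => Sum.inl '' S.U i) (fun i => Sum.inr '' S'.U i)
  isOpen_U := by
    rintro (i | i)
    · exact isOpenMap_inl _ (S.isOpen_U i)
    · exact isOpenMap_inr _ (S'.isOpen_U i)
  cover := by
    rintro (x | x)
    · obtain ⟨i, hi⟩ := S.cover x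
      exact ⟨Sum.inl i, x, hi, rfl⟩
    · obtain ⟨i, hi⟩ := S'.cover x
      exact ⟨Sum.inr i, x, hi, rfl⟩
  frame
    | .inl i, .inl x => S.frame i x
    | .inr i, .inr x => S'.frame i x
    -- Arbitrary values: these points lie outside the open set with that index.
    | .inl _, .inr _ => ContinuousLinearEquiv.refl ℝ (Rn n)
    | .inr _, .inl _ => ContinuousLinearEquiv.refl ℝ (Rn n)
  continuousOn_frame := by
    rintro (i | i) v
    · exact Topology.IsEmbedding.inl.isInducing.continuousOn_image_iff.2
        (continuous_tangentBundle_inl.comp_continuousOn (S.continuousOn_frame i v))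
    · exact Topology.IsEmbedding.inr.isInducing.continuousOn_image_iff.2
        (continuous_tangentBundle_inr.comp_continuousOn (S'.continuousOn_frame i v))
  lift
    | .inl i, .inl j, .inl x => S.lift i j x
    | .inr i, .inr j, .inr x => S'.lift i j x
    -- Also arbitrary, since sets of the cover from different summands do not meet.
    | _, _, _ => 1
  lift_mem := by
    rintro (i | i) (j | j) _ ⟨⟨x, hi, rfl⟩, ⟨y, hj, hxy⟩⟩
    · obtain rfl := Sum.inl_injective hxy
      exact S.lift_mem i j y ⟨hi, hj⟩
    · simp at hxy
    · simp at hxy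
    · obtain rfl := Sum.inr_injective hxy
      exact S'.lift_mem i j y ⟨hi, hj⟩
  continuousOn_lift := by
    rintro (i | i) (j | j) φ
    · simp only [Sum.elim_inl]
      rw [← Set.image_inter Sum.inl_injective, Topology.IsEmbedding.inl.isInducing.continuousOn_image_iff]
      exact S.continuousOn_lift i j φ
    · rintro _ ⟨⟨x, hi, rfl⟩, ⟨y, hj, hxy⟩⟩
      simp at hxy
    · rintro _ ⟨⟨x, hi, rfl⟩, ⟨y, hj, hxy⟩⟩
      simp at hxy
    · simp only [Sum.elim_inr]
      rw [← Set.image_inter Sum.inr_injective, Topology.IsEmbedding.inr.isInducing.continuousOn_image_iff]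
      exact S'.continuousOn_lift i j φ
  lift_covers := by
    rintro (i | i) (j | j) _ ⟨⟨x, hi, rfl⟩, ⟨y, hj, hxy⟩⟩ v
    · obtain rfl := Sum.inl_injective hxy
      exact S.lift_covers i j y ⟨hi, hj⟩ v
    · simp at hxy
    · simp at hxy
    · obtain rfl := Sum.inr_injective hxy
      exact S'.lift_covers i j y ⟨hi, hj⟩ v
  cocycle := by
    rintro (i | i) (j | j) (k | k) _ ⟨⟨⟨x, hi, rfl⟩, ⟨y, hj, hxy⟩⟩, ⟨w, hk, hxw⟩⟩ <;>
      simp only [reduceCtorEq, Sum.inl.injEq, Sum.inr.injEq] at hxy hxw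
    · subst hxy hxw
      exact S.cocycle i j k w ⟨⟨hi, hj⟩, hk⟩
    · subst hxy hxw
      exact S'.cocycle i j k w ⟨⟨hi, hj⟩, hk⟩

theorem IsSpin.sum (h : IsSpin n L) (h' : IsSpin n L') : IsSpin n (L ⊕ L') :=
  ⟨h.some.sum h'.some⟩

end Spin
-- Halving the error term and passing to the limit
/-- The inequality `R(f) ≥ ½ dim H_*(L; Λ) - K` for all admissible exact Lagrangian immersions. -/
def DoublePointBound (Λ : Type) [Field Λ] (K : ℝ≥0) : Prop :=
  ∀ (n : ℕ) (L : Type) [TopologicalSpace L] [T2Space L] [CompactSpace L]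
    [ChartedSpace (Rn n) L] [IsManifold 𝓘(ℝ, Rn n) ∞ L] (f : L → Cn n), 1 ≤ n →
    (IsSpin n L ∨ Nonempty (Λ ≃+* ZMod 2)) → IsExactLagrangianImmersion f →
    IsSelfTransverse f →
    (dimHomology Λ L : ℝ≥0∞) / 2 - (K : ℝ≥0∞) ≤ (numDoublePoints f : ℝ≥0∞)

/-- Two disjoint copies of an immersion double both sides of the inequality, so that the error
term is halved. -/
theorem DoublePointBound.half {Λ : Type} [Field Λ] {K : ℝ≥0} (h : DoublePointBound Λ K) :
    DoublePointBound Λ (K / 2) := by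
  intro n L _ _ _ _ _ f hn hspin hf hst
  obtain ⟨c, hc, hdisj⟩ := exists_real_translation_disjoint hn hf.smooth.continuous
  have hg := hf.add_const hc
  have key := h n (L ⊕ L) (Sum.elim f fun x => f x + c) hn
    (hspin.imp_left fun hs => hs.sum hs) (hf.sumElim hg)
    (hst.sumElim hf.smooth hg.smooth (hst.add_const c) hdisj)
  have hR : numDoublePoints (Sum.elim f fun x => f x + c) ≤
      numDoublePoints f + numDoublePoints f :=
    (numDoublePoints_sumElim_le hdisj).trans
      (add_le_add_right (numDoublePoints_add_const_le f c) _)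
  have hR' : (numDoublePoints (Sum.elim f fun x => f x + c) : ℝ≥0∞) ≤
      2 * (numDoublePoints f : ℝ≥0∞) := by
    rw [two_mul]; exact_mod_cast hR
  have hd : 2 * (dimHomology Λ L : ℝ≥0∞) ≤ (dimHomology Λ (L ⊕ L) : ℝ≥0∞) := by
    rw [two_mul]; exact_mod_cast dimHomology_add_le_sum Λ L L
  rw [ENNReal.coe_div two_ne_zero, ENNReal.coe_ofNat, tsub_le_iff_right]
  -- With the error term moved to the right, doubling turns the goal into `dim ≤ 2 R + K`; this is
  -- reversible because `2` is neither zero nor infinite.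
  refine (ENNReal.mul_le_mul_iff_right two_ne_zero ENNReal.ofNat_ne_top).1 ?_
  rw [mul_add, ENNReal.mul_div_cancel two_ne_zero ENNReal.ofNat_ne_top,
    ENNReal.mul_div_cancel two_ne_zero ENNReal.ofNat_ne_top]
  calc (dimHomology Λ L : ℝ≥0∞) ≤ (dimHomology Λ (L ⊕ L) : ℝ≥0∞) / 2 := by
        rwa [ENNReal.le_div_iff_mul_le (.inl two_ne_zero) (.inl ENNReal.ofNat_ne_top), mul_comm]
    _ ≤ (numDoublePoints (Sum.elim f fun x => f x + c) : ℝ≥0∞) + K := tsub_le_iff_right.1 key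
    _ ≤ 2 * (numDoublePoints f : ℝ≥0∞) + K := by gcongr

theorem DoublePointBound.div_two_pow {Λ : Type} [Field Λ] {K : ℝ≥0} (h : DoublePointBound Λ K)
    (m : ℕ) : DoublePointBound Λ (K / 2 ^ m) := by
  induction m with
  | zero => simpa using h
  | succ m ih => rw [pow_succ, ← div_div]; exact ih.half

end ExactLagrangian

end

theorem mainTheorem11 (Λ : Type) [Field Λ]
    (hΛ : Nonempty (Λ ≃+* ℚ) ∨ ∃ p : ℕ, p.Prime ∧ Nonempty (Λ ≃+* ZMod p))
    (hK : ∃ K : ℝ≥0, ∀ (n : ℕ) (L : Type) [TopologicalSpace L] [T2Space L] [CompactSpace L]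
      [ChartedSpace (ExactLagrangian.Rn n) L] [IsManifold 𝓘(ℝ, ExactLagrangian.Rn n) ∞ L]
      (f : L → ExactLagrangian.Cn n), 1 ≤ n →
      (ExactLagrangian.IsSpin n L ∨ Nonempty (Λ ≃+* ZMod 2)) →
      ExactLagrangian.IsExactLagrangianImmersion f →
      ExactLagrangian.IsSelfTransverse f →
      (ExactLagrangian.dimHomology Λ L : ℝ≥0∞) / 2 - (K : ℝ≥0∞) ≤
        (ExactLagrangian.numDoublePoints f : ℝ≥0∞)) :
    ∀ (n : ℕ) (L : Type) [TopologicalSpace L] [T2Space L] [CompactSpace L]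
      [ChartedSpace (ExactLagrangian.Rn n) L] [IsManifold 𝓘(ℝ, ExactLagrangian.Rn n) ∞ L]
      (f : L → ExactLagrangian.Cn n), 1 ≤ n →
      (ExactLagrangian.IsSpin n L ∨ Nonempty (Λ ≃+* ZMod 2)) →
      ExactLagrangian.IsExactLagrangianImmersion f →
      ExactLagrangian.IsSelfTransverse f →
      (ExactLagrangian.dimHomology Λ L : ℝ≥0∞) / 2 ≤
        (ExactLagrangian.numDoublePoints f : ℝ≥0∞) := by
  obtain ⟨K, hK⟩ := hK
  intro n L _ _ _ _ _ f hn hspin hf hst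
  refine ENNReal.le_of_forall_pos_le_add fun ε hε _ => ?_
  -- Enough halvings to bring the error below `ε`: `K / ε < 2 ^ m`.
  obtain ⟨m, hm⟩ := pow_unbounded_of_one_lt (K / ε) (one_lt_two (α := ℝ≥0))
  have hKm : K / 2 ^ m ≤ ε := by
    rw [div_le_iff₀ (by positivity), mul_comm]
    exact ((div_lt_iff₀ hε).1 hm).le
  have h := ExactLagrangian.DoublePointBound.div_two_pow hK m n L f hn hspin hf hst
  exact (tsub_le_iff_right.1 h).trans (by gcongr)
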